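/- \textbf{Setting.} Let $N\ge 1$ be the number of pulses in a block. Alice chooses $x\in\{0,1\}^N$ with an arbitrary prior probability $P(x)$ and puts $l_i=x_i\oplus x_{i-1}$ for $2\le i\le N$. For each $x$, Eve and Bob share a pure state $|\Psi^x\rangle$, a unit vector in $\mathcal H_E\otimes\mathcal F_B$, where $\mathcal H_E$ is any complex Hilbert space (Eve holds the purification) and $\mathcal F_B$ is the Fock space of the $N$ received modes $a_1,\dots,a_N$. Bob injects the vacuum $|vac\rangle$ in modes $b_1,\dots,b_N$ and has, for $2\le i\le N$ and $j\in\{0,1\}$, an ideal detector $DET_i^j$ on the output mode \[ d_i^{1}=\tfrac12(a_i-a_{i-1})+\tfrac{\mathrm i}{2}(b_i+b_{i-1}),\qquad d_i^{0}=\tfrac{\mathrm i}{2}(a_i+a_{i-1})+\tfrac12(b_{i-1}-b_i); \] the two remaining output modes $(a_1+\mathrm i b_1)/\sqrt2$ and $(\mathrm i a_N+b_N)/\sqrt2$ are not monitored. For photon numbers $m=(m_k)$ of the $2N$ output modes $d_k$ (the two unmonitored modes included) let \[ |E^x_m\rangle=\Big(\prod_k m_k!\Big)^{-1/2}\langle vac|\prod_k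 d_k^{\,m_k}\,|\Psi^x\rangle|vac\rangle\in\mathcal H_E , \] where $\langle vac|$ is the vacuum of all $2N$ modes. Bob announces $z\in\{0,1\}^N$ with $z_1=0$ and, for $i\ge2$, $z_i=1$ if and only if $DET_i^0$ or $DET_i^1$ registers at least one photon; write $m\sim z$ if the photon numbers $m$ lead to the announcement $z$, and let $w(z)$ be the number of ones in $z$. Put \[ P(z|x)=\sum_{m\sim z}\|E_m^x\|^2,\qquad \rho_E^{N,x,z}=\frac1{P(z|x)}\sum_{m\sim z}|E^x_m\rangle\langle E^x_m| , \] \[ P(z,x)=P(z|x)P(x),\quad P(z)=\sum_xP(z,x),\quad P(x|z)=\frac{P(z,x)}{P(z)},\quad \rho_E^{N,z}=\sum_xP(x|z)\,\rho_E^{N,x,z} \] (conditional probabilities and states with respect to an event of probability zero are taken to be $0$). There is \emph{no bit error} if for every $x$ and every $2\le i\le N$ the output mode of the detector that contradicts Alice's phase difference is in the vacuum state: $d_i^{\,l_i\oplus1}|\Psi^x\rangle|vac\rangle=0$. \textbf{Lemma 2.} Suppose that there is no bit error. Then for every $x$ the outcome probabilities satisfy $\sum_m\|E^x_m\|^2=1$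 (so that all the series above converge), and for all $z,z'\in\{0,1\}^N$ with $z_1=z'_1=0$ and $w(z)=w(z')$ we have, for every $x$, \[ \rho_E^{N,x,z}=\rho_E^{N,x,z'},\qquad \rho_E^{N,z}=\rho_E^{N,z'}, \] \[ P(z|x)=P(z'|x),\quad P(z,x)=P(z',x),\quad P(z)=P(z'),\quad P(x|z)=P(x|z'). \] So Eve's state depends only on how many detections Bob had, not on where they occurred. -/

import Mathlib

noncomputable section

namespace DPS

/-- Vectors of `E ⊗ (Fock space of the modes ι)`, written in the occupation number basis: the value
at `k : ι → ℕ` is the `E`-component along the number state `|k⟩`.  No growth condition is imposed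
here, so that annihilation operators are defined everywhere. -/
abbrev FockFun (ι : Type*) (E : Type*) : Type _ := (ι → ℕ) → E

/-- The annihilation operator of the mode `i`, which maps `|k⟩` to `√(k i) |k - δᵢ⟩`. -/
def annih {ι : Type*} [DecidableEq ι] {E : Type*} [AddCommGroup E] [Module ℂ E] (i : ι) :
    Module.End ℂ (FockFun ι E) where
  toFun F k := ((Real.sqrt ((k i : ℝ) + 1) : ℝ) : ℂ) • F (k + Pi.single i 1)
  map_add' F G := by
    funext k
    simp [smul_add]
  map_smul' c F := by
    funext k
    simp [smul_comm c]

theorem annih_commute {ι : Type*} [DecidableEq ι] {E : Type*} [AddCommGroup E] [Module ℂ E]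
    (i j : ι) : Commute (annih i : Module.End ℂ (FockFun ι E)) (annih j) := by
  by_cases h : i = j
  · subst h
    exact Commute.refl _
  · apply LinearMap.ext
    intro F
    funext k
    simp [annih, h, Ne.symm h, smul_smul, mul_comm, add_right_comm]

/-- The `2N` input modes of Bob's apparatus, `N = n + 1`: the received modes `a i` and the modes
`b i` entering through the empty ports of the first beam splitters. -/
abbrev InMode (n : ℕ) : Type := Fin (n + 1) ⊕ Fin (n + 1)

/-- The `2N` output modes of Bob's apparatus, `N = n + 1`: for each pair of adjacent pulses
`i.castSucc`, `i.succ` the two monitored modes `det i false` (detector for phase difference zero)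
and `det i true` (detector for a nonzero phase difference), and the two unmonitored modes, one
coming from the first pulse and one from the last pulse. -/
inductive OutMode (n : ℕ) : Type where
  | det (i : Fin n) (j : Bool) : OutMode n
  | first : OutMode n
  | last : OutMode n
  deriving DecidableEq, Fintype

section

variable {n : ℕ} {E : Type*} [AddCommGroup E] [Module ℂ E]

/-- The annihilation operator of the received mode `a i`. -/
def aOp (i : Fin (n + 1)) : Module.End ℂ (FockFun (InMode n) E) := annih (Sum.inl i)

/-- The annihilation operator of the empty-port mode `b i`. -/
def bOp (i : Fin (n + 1)) : Module.End ℂ (FockFun (InMode n) E) := annih (Sum.inr i)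

/-- The annihilation operators of the output modes, in terms of the input modes.
The first beam splitter at fiber `i` produces `(a i + 𝐢 b i)/√2` and `(𝐢 a i + b i)/√2`; the first
of these at fiber `i.succ` and the second (delayed) one at fiber `i.castSucc` interfere on the beam
splitter in front of the detectors with index `i`. -/
def outOp : OutMode n → Module.End ℂ (FockFun (InMode n) E)
  | .det i true =>
      (1 / 2 : ℂ) • (aOp i.succ - aOp i.castSucc)
        + (Complex.I / 2) • (bOp i.succ + bOp i.castSucc)
  | .det i false =>
      (Complex.I / 2) • (aOp i.succ + aOp i.castSucc)
        + (1 / 2 : ℂ) • (bOp i.castSucc - bOp i.succ)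
  | .first => (((Real.sqrt 2)⁻¹ : ℝ) : ℂ) • (aOp 0 + Complex.I • bOp 0)
  | .last => (((Real.sqrt 2)⁻¹ : ℝ) : ℂ) •
      (Complex.I • aOp (Fin.last n) + bOp (Fin.last n))

theorem outOp_commute (k l : OutMode n) :
    Commute (outOp k : Module.End ℂ (FockFun (InMode n) E)) (outOp l) := by
  have key : ∀ (k : OutMode n) (T : Module.End ℂ (FockFun (InMode n) E)),
      (∀ i, Commute (annih i) T) → Commute (outOp k) T := by
    intro k T hT
    have ha : ∀ i, Commute (aOp i) T := fun i => hT _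
    have hb : ∀ i, Commute (bOp i) T := fun i => hT _
    rcases k with ⟨i, j⟩ | _ | _
    · cases j
      · exact (((ha _).add_left (ha _)).smul_left _).add_left
          (((hb _).sub_left (hb _)).smul_left _)
      · exact (((ha _).sub_left (ha _)).smul_left _).add_left
          (((hb _).add_left (hb _)).smul_left _)
    · exact ((ha _).add_left ((hb _).smul_left _)).smul_left _
    · exact (((ha _).smul_left _).add_left (hb _)).smul_left _
  exact key k _ fun i => (key l _ fun j => annih_commute j i).symm

/-- `Ψ ⊗ |vac⟩`, the vacuum being injected through all modes `b i`. -/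
def withVac (Ψ : FockFun (Fin (n + 1)) E) : FockFun (InMode n) E :=
  fun k => if ∀ i, k (Sum.inr i) = 0 then Ψ (fun i => k (Sum.inl i)) else 0

/-- The amplitude `(∏ₖ mₖ!)^(-1/2) ⟨vac| ∏ₖ (outOp k)^(mₖ) (Ψ ⊗ |vac⟩) ∈ E` of the event that each
output mode `k` contains exactly `m k` photons: the (unnormalized) state of `E` after the projection
`(∏ₖ mₖ!)⁻¹ (∏ₖ (outOp k)†^(mₖ)) |vac⟩⟨vac| (∏ₖ (outOp k)^(mₖ))`. -/
def amp (Ψ : FockFun (Fin (n + 1)) E) (m : OutMode n → ℕ) : E :=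
  (((Real.sqrt (∏ k, (m k).factorial : ℕ))⁻¹ : ℝ) : ℂ) •
    (Finset.univ.noncommProd (fun k => (outOp k : Module.End ℂ (FockFun (InMode n) E)) ^ m k)
      (fun k _ l _ _ => (outOp_commute k l).pow_pow (m k) (m l))) (withVac Ψ) 0

/-- Alice's phase differences: `phaseDiff x i` belongs to the pulses `i.castSucc` and `i.succ`. -/
def phaseDiff (x : Fin (n + 1) → Bool) (i : Fin n) : Bool := xor (x i.succ) (x i.castSucc)

/-- No bit error for Alice's string `x`: at every position the output mode of the detector that
contradicts Alice's phase difference is in the vacuum state. -/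
def NoBitError (x : Fin (n + 1) → Bool) (Ψ : FockFun (Fin (n + 1)) E) : Prop :=
  ∀ i : Fin n, outOp (.det i (!phaseDiff x i)) (withVac Ψ) = 0

end

/-- Bob's announcement for the photon numbers `m`: its first entry is `0`, and the entry
`i.succ` is `1` iff at least one of the two detectors at this position gets a count. -/
def announce {n : ℕ} (m : OutMode n → ℕ) : Fin (n + 1) → Bool :=
  Fin.cons false fun i => decide (0 < m (.det i false) ∨ 0 < m (.det i true))

/-- The weight of a binary string. -/
def weight {N : ℕ} (z : Fin N → Bool) : ℕ := (Finset.univ.filter fun i => z i = true).card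

section

variable {n : ℕ} {E : Type*} [NormedAddCommGroup E] [InnerProductSpace ℂ E]

/-- The Hilbert space `E ⊗ (Fock space of Bob's N = n + 1 received modes)`, realized as the space of
square summable `E`-valued functions of the occupation numbers. -/
abbrev EveBob (n : ℕ) (E : Type*) [NormedAddCommGroup E] : Type _ :=
  lp (fun _ : Fin (n + 1) → ℕ => E) 2

/-- `P(z|x)` when Eve and Bob share `Ψ = Ψ x`. -/
def probZGivenX (Ψ : EveBob n E) (z : Fin (n + 1) → Bool) : ℝ :=
  ∑' m : {m : OutMode n → ℕ // announce m = z}, ‖amp (Ψ : FockFun (Fin (n + 1)) E) m.1‖ ^ 2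

/-- Eve's state conditioned on `x` and `z`, when Eve and Bob share `Ψ = Ψ x`: the mixture of her
collapsed states over all photon numbers compatible with the announcement `z`. -/
def eveStateXZ (Ψ : EveBob n E) (z : Fin (n + 1) → Bool) : E →L[ℂ] E :=
  (((probZGivenX Ψ z)⁻¹ : ℝ) : ℂ) •
    ∑' m : {m : OutMode n → ℕ // announce m = z},
      InnerProductSpace.rankOne ℂ (amp (Ψ : FockFun (Fin (n + 1)) E) m.1)
        (amp (Ψ : FockFun (Fin (n + 1)) E) m.1)

/-- The joint probability `P(z, x) = P(z|x) P(x)`. -/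
def probZX (p : (Fin (n + 1) → Bool) → ℝ) (Ψ : (Fin (n + 1) → Bool) → EveBob n E)
    (z x : Fin (n + 1) → Bool) : ℝ :=
  probZGivenX (Ψ x) z * p x

/-- `P(z) = ∑ₓ P(z, x)`. -/
def probZ (p : (Fin (n + 1) → Bool) → ℝ) (Ψ : (Fin (n + 1) → Bool) → EveBob n E)
    (z : Fin (n + 1) → Bool) : ℝ :=
  ∑ x, probZX p Ψ z x

/-- `P(x|z) = P(z, x) / P(z)`. -/
def probXGivenZ (p : (Fin (n + 1) → Bool) → ℝ) (Ψ : (Fin (n + 1) → Bool) → EveBob n E)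
    (x z : Fin (n + 1) → Bool) : ℝ :=
  probZX p Ψ z x / probZ p Ψ z

/-- Eve's state conditioned on `z` only, the average of her states over `P(x|z)`. -/
def eveStateZ (p : (Fin (n + 1) → Bool) → ℝ) (Ψ : (Fin (n + 1) → Bool) → EveBob n E)
    (z : Fin (n + 1) → Bool) : E →L[ℂ] E :=
  ∑ x, ((probXGivenZ p Ψ x z : ℝ) : ℂ) • eveStateXZ (Ψ x) z

end

end DPS

end

noncomputable section

namespace DPS

/-! ### Products of commuting operators on a vector where all are multiples of one operator. -/

section Algebra

/-! The `b` modes are empty, so absence of bit errors says that adjacent received modes act on the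
state alike up to the sign given by Alice's phase difference. Hence each `a i` acts as `± a 0`, and
each output mode as a scalar multiple of `a 0` (`NoBitError.outOp_eq`). All operators commute, so
the amplitude of photon numbers `m` with total `M` is a scalar times the single vector `⟨vac| a₀ᴹ
|Ψ⟩` (`NoBitError.amp_eq`). The squared modulus of the scalar is `∏ w_k ^ m_k / m_k!`, where the
weight `w_k` is 1 for a detector agreeing with Alice, 0 for a contradicting one and 1/2 for each
unmonitored mode.

Equal weight: announcements with equally many ones differ by a permutation of the positions. It
lifts to a permutation of the output modes preserving the weights `w_k` (`detPerm`), and both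
`‖E_m‖²` and `|E_m⟩⟨E_m|` are unchanged by it, so reindexing identifies the sums over `m ∼ z` and `m
∼ z'`. The joint, marginal and posterior quantities are built from these.

Normalization: the input number distribution has the same form with weight 1 on each of the `N`
received modes. By the multinomial theorem the sum sees only the total weight, which is `N` for
inputs and outputs alike, so it equals `‖Ψ‖²`. -/

theorem pow_apply_of_commute {V : Type*} [AddCommGroup V] [Module ℂ V] {T A : Module.End ℂ V}
    (hTA : Commute T A) {v : V} {c : ℂ} (h : T v = c • A v) (p : ℕ) :
    (T ^ p) v = c ^ p • (A ^ p) v := by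
  induction p with
  | zero => simp
  | succ p ih =>
    have hc : T ((A ^ p) v) = (A ^ p) (T v) := by
      have := congrArg (fun S : Module.End ℂ V => S v) (hTA.pow_right p).eq
      simpa using this
    rw [pow_succ', Module.End.mul_apply, ih, map_smul, hc, h, map_smul, smul_smul, pow_succ c,
      pow_succ A, Module.End.mul_apply]

theorem noncommProd_pow_apply {κ V : Type*} [AddCommGroup V] [Module ℂ V]
    {T : κ → Module.End ℂ V} {A : Module.End ℂ V} (hTA : ∀ k, Commute (T k) A) {v : V} {c : κ → ℂ}
    (h : ∀ k, T k v = c k • A v) (m : κ → ℕ) (s : Finset κ)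
    (hs : (s : Set κ).Pairwise (Function.onFun Commute fun k => T k ^ m k)) :
    s.noncommProd (fun k => T k ^ m k) hs v = (∏ k ∈ s, c k ^ m k) • (A ^ ∑ k ∈ s, m k) v := by
  classical
  induction s using Finset.induction_on with
  | empty => simp
  | insert a s ha ih =>
    rw [Finset.noncommProd_insert_of_notMem _ _ _ _ ha, Module.End.mul_apply, ih, map_smul]
    have hc := congrArg (fun S : Module.End ℂ V => S v)
      (((hTA a).pow_pow (m a) (∑ k ∈ s, m k)).eq)
    simp only [Module.End.mul_apply] at hc
    rw [hc, pow_apply_of_commute (hTA a) (h a), map_smul, smul_smul, Finset.prod_insert ha,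
      Finset.sum_insert ha, add_comm, pow_add, Module.End.mul_apply, mul_comm]

theorem annih_pow_apply_zero {ι : Type*} [DecidableEq ι] {E : Type*} [AddCommGroup E] [Module ℂ E]
    (i : ι) (p : ℕ) (F : FockFun ι E) :
    ((annih i : Module.End ℂ (FockFun ι E)) ^ p) F 0
      = ((Real.sqrt (p.factorial : ℝ) : ℝ) : ℂ) • F (Pi.single i p) := by
  induction p generalizing F with
  | zero => simp
  | succ p ih =>
    rw [pow_succ, Module.End.mul_apply, ih]
    simp only [annih, LinearMap.coe_mk, AddHom.coe_mk, Pi.single_eq_same, smul_smul,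
      ← Pi.single_add]
    congr 1
    rw [Nat.factorial_succ, Nat.cast_mul, mul_comm (((p + 1 : ℕ) : ℝ)),
      Real.sqrt_mul (Nat.cast_nonneg _)]
    push_cast
    rfl

end Algebra

/-! ### Shift-invariant functions and multinomial sums. -/

section Combinatorics

theorem eq_single_of_shift_invariant {ι α : Type*} [Fintype ι] [DecidableEq ι] (i₀ : ι)
    (g : (ι → ℕ) → α) (hg : ∀ (k : ι → ℕ) i, g (k + (Pi.single i 1 : ι → ℕ)) = g (k + (Pi.single i₀ 1 : ι → ℕ))) (k : ι → ℕ) :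
    g k = g (Pi.single i₀ (∑ i, k i)) := by
  obtain ⟨M, hM⟩ : ∃ M, ∑ i, k i = M := ⟨_, rfl⟩
  rw [hM]
  induction M generalizing g k with
  | zero =>
    have : k = 0 := by
      funext i
      exact (Finset.sum_eq_zero_iff.1 hM) i (Finset.mem_univ i)
    simp [this]
  | succ M ih =>
    obtain ⟨i, hi⟩ : ∃ i, k i ≠ 0 := by
      by_contra! h
      simp [h] at hM
    obtain ⟨k', rfl⟩ : ∃ k' : ι → ℕ, k = k' + (Pi.single i 1 : ι → ℕ) := by
      refine ⟨k - (Pi.single i 1 : ι → ℕ), ?_⟩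
      funext j
      by_cases hj : j = i
      · subst hj
        simp
        omega
      · simp [hj]
    have hk' : ∑ j, k' j = M := by
      simpa [Finset.sum_add_distrib] using hM
    -- The induction hypothesis is applied to the shifted function, which inherits the invariance;
    -- this is why `g` is generalized.
    rw [hg, ih (fun k => g (k + (Pi.single i₀ 1 : ι → ℕ))) (fun k j => ?_) k' hk', ← Pi.single_add]
    have h1 := hg (k + (Pi.single i₀ 1 : ι → ℕ)) j
    rwa [add_right_comm] at h1

theorem multinomial_term_nonneg {κ : Type*} [Fintype κ] {w : κ → ℝ} (hw : ∀ k, 0 ≤ w k)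
    {G : ℕ → ℝ} (hG : ∀ M, 0 ≤ G M) (m : κ → ℕ) :
    0 ≤ (∏ k, w k ^ m k / (m k).factorial) * G (∑ k, m k) :=
  mul_nonneg (Finset.prod_nonneg fun k _ => div_nonneg (pow_nonneg (hw k) _) (Nat.cast_nonneg _))
    (hG _)

/-- Group the photon numbers by their total `M` and apply the multinomial theorem to each finite
fiber. In `ENNReal` the regrouping needs no summability. -/
theorem tsum_ofReal_multinomial {κ : Type*} [Fintype κ] [DecidableEq κ] (w : κ → ℝ)
    (hw : ∀ k, 0 ≤ w k) (G : ℕ → ℝ) (hG : ∀ M, 0 ≤ G M) :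
    ∑' m : κ → ℕ, ENNReal.ofReal ((∏ k, w k ^ m k / (m k).factorial) * G (∑ k, m k))
      = ∑' M : ℕ, ENNReal.ofReal ((∑ k, w k) ^ M / M.factorial * G M) := by
  rw [← (Equiv.sigmaFiberEquiv (fun m : κ → ℕ => ∑ k, m k)).tsum_eq, ENNReal.tsum_sigma']
  refine tsum_congr fun M => ?_
  have hfib : ∀ m : κ → ℕ, m ∈ Finset.piAntidiag Finset.univ M ↔ ∑ k, m k = M := by
    intro m
    simp [Finset.mem_piAntidiag]
  have hsum := ((Equiv.subtypeEquivRight hfib).tsum_eq (fun m : {m : κ → ℕ // ∑ k, m k = M} =>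
    ENNReal.ofReal ((∏ k, w k ^ m.1 k / (m.1 k).factorial) * G (∑ k, m.1 k)))).symm
  refine hsum.trans ?_
  refine (Finset.tsum_subtype (Finset.piAntidiag Finset.univ M) (fun m : κ → ℕ =>
    ENNReal.ofReal ((∏ k, w k ^ m k / (m k).factorial) * G (∑ k, m k)))).trans ?_
  rw [← ENNReal.ofReal_sum_of_nonneg fun m _ => multinomial_term_nonneg hw hG m]
  congr 1
  rw [Finset.sum_pow_eq_sum_piAntidiag, Finset.sum_div, Finset.sum_mul]
  refine Finset.sum_congr rfl fun m hm => ?_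
  have hmM := (hfib m).1 hm
  rw [hmM]
  congr 1
  have hmul := Nat.multinomial_spec Finset.univ m
  rw [hmM] at hmul
  have hmul' : (∏ k, ((m k).factorial : ℝ)) * (Nat.multinomial Finset.univ m : ℝ)
      = M.factorial := by exact_mod_cast hmul
  have h1 : (∏ k, ((m k).factorial : ℝ)) ≠ 0 :=
    Finset.prod_ne_zero_iff.2 fun k _ => by positivity
  have h2 : (M.factorial : ℝ) ≠ 0 := by positivity
  rw [Finset.prod_div_distrib, div_eq_div_iff h1 h2, ← hmul']
  ring

theorem hasSum_iff_tsum_ofReal {κ : Type*} {f : κ → ℝ} (hf : ∀ k, 0 ≤ f k) {s : ℝ} (hs : 0 ≤ s) :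
    HasSum f s ↔ ∑' k, ENNReal.ofReal (f k) = ENNReal.ofReal s := by
  constructor
  · intro h
    rw [← h.tsum_eq, ENNReal.ofReal_tsum_of_nonneg hf h.summable]
  · intro h
    have hne : ∑' k, ENNReal.ofReal (f k) ≠ ⊤ := h ▸ ENNReal.ofReal_ne_top
    have hsum := ENNReal.hasSum_toReal hne
    rw [← ENNReal.tsum_toReal_eq (ENNReal.ne_top_of_tsum_ne_top hne), h,
      ENNReal.toReal_ofReal hs] at hsum
    simpa only [ENNReal.toReal_ofReal (hf _)] using hsum

/-- Two weightings of total weight `W` turn the same radial profile into the same total mass. -/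
theorem hasSum_multinomial_iff {κ κ' : Type*} [Fintype κ] [DecidableEq κ] [Fintype κ']
    [DecidableEq κ'] {w : κ → ℝ} {w' : κ' → ℝ} (hw : ∀ k, 0 ≤ w k) (hw' : ∀ k, 0 ≤ w' k)
    (h : ∑ k, w k = ∑ k, w' k) {G : ℕ → ℝ} (hG : ∀ M, 0 ≤ G M) {s : ℝ} (hs : 0 ≤ s) :
    HasSum (fun m : κ → ℕ => (∏ k, w k ^ m k / (m k).factorial) * G (∑ k, m k)) s ↔
      HasSum (fun m : κ' → ℕ => (∏ k, w' k ^ m k / (m k).factorial) * G (∑ k, m k)) s := by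
  rw [hasSum_iff_tsum_ofReal (multinomial_term_nonneg hw hG) hs,
    hasSum_iff_tsum_ofReal (multinomial_term_nonneg hw' hG) hs,
    tsum_ofReal_multinomial w hw G hG, tsum_ofReal_multinomial w' hw' G hG, h]

end Combinatorics

/-! ### Action of the output modes on a state without bit errors. -/

section Modes

theorem withVac_injective {n : ℕ} {E : Type*} [AddCommGroup E] :
    Function.Injective (withVac : FockFun (Fin (n + 1)) E → FockFun (InMode n) E) := by
  intro Ψ Φ h
  funext k
  simpa [withVac] using congrFun h (Sum.elim k 0)

variable {n : ℕ} {E : Type*} [AddCommGroup E] [Module ℂ E]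

theorem bOp_withVac (i : Fin (n + 1)) (Ψ : FockFun (Fin (n + 1)) E) : bOp i (withVac Ψ) = 0 := by
  funext k
  have : ¬ ∀ j, (k + Pi.single (Sum.inr i) 1 : InMode n → ℕ) (Sum.inr j) = 0 := fun h => by
    simpa using h i
  simp only [bOp, annih, LinearMap.coe_mk, AddHom.coe_mk, withVac, if_neg this, smul_zero,
    Pi.zero_apply]

theorem aOp_withVac (i : Fin (n + 1)) (Ψ : FockFun (Fin (n + 1)) E) :
    aOp i (withVac Ψ) = withVac (annih i Ψ) := by
  funext k
  have hk : (fun j => (k + Pi.single (Sum.inl i) 1 : InMode n → ℕ) (Sum.inl j))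
      = (fun j => k (Sum.inl j)) + Pi.single i 1 := by
    funext j
    simp [Pi.single_apply]
  have hk' : (∀ j, (k + Pi.single (Sum.inl i) 1 : InMode n → ℕ) (Sum.inr j) = 0) ↔ ∀ j, k (Sum.inr j) = 0 := by
    simp
  simp only [aOp, annih, LinearMap.coe_mk, AddHom.coe_mk, withVac, hk, hk']
  split_ifs <;> simp

theorem withVac_smul (c : ℂ) (Ψ : FockFun (Fin (n + 1)) E) :
    withVac (c • Ψ) = c • withVac Ψ := by
  funext k
  simp only [withVac, Pi.smul_apply]
  split_ifs <;> simp

theorem commute_outOp_aOp (k : OutMode n) (i : Fin (n + 1)) :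
    Commute (outOp k : Module.End ℂ (FockFun (InMode n) E)) (aOp i) := by
  have ha : ∀ j, Commute (aOp j : Module.End ℂ (FockFun (InMode n) E)) (aOp i) :=
    fun j => annih_commute _ _
  have hb : ∀ j, Commute (bOp j : Module.End ℂ (FockFun (InMode n) E)) (aOp i) :=
    fun j => annih_commute _ _
  rcases k with ⟨i, j⟩ | _ | _
  · cases j
    · exact (((ha _).add_left (ha _)).smul_left _).add_left
        (((hb _).sub_left (hb _)).smul_left _)
    · exact (((ha _).sub_left (ha _)).smul_left _).add_left
        (((hb _).add_left (hb _)).smul_left _)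
  · exact ((ha _).add_left ((hb _).smul_left _)).smul_left _
  · exact (((ha _).smul_left _).add_left (hb _)).smul_left _

/-- The sign of pulse `i` relative to pulse `0`. -/
def relSign (x : Fin (n + 1) → Bool) (i : Fin (n + 1)) : ℂ := if xor (x i) (x 0) then -1 else 1

theorem norm_relSign (x : Fin (n + 1) → Bool) (i : Fin (n + 1)) : ‖relSign x i‖ = 1 := by
  unfold relSign
  split_ifs <;> simp

theorem relSign_succ (x : Fin (n + 1) → Bool) (i : Fin n) :
    relSign x i.succ = (if phaseDiff x i then -1 else 1) * relSign x i.castSucc := by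
  unfold relSign phaseDiff
  cases x i.succ <;> cases x i.castSucc <;> cases x 0 <;> simp

theorem NoBitError.aOp_succ {x : Fin (n + 1) → Bool} {Ψ : FockFun (Fin (n + 1)) E}
    (h : NoBitError x Ψ) (i : Fin n) :
    aOp i.succ (withVac Ψ)
      = (if phaseDiff x i then -1 else 1 : ℂ) • aOp i.castSucc (withVac Ψ) := by
  have hi := h i
  cases hp : phaseDiff x i
  · simp only [hp, Bool.not_false, outOp, LinearMap.add_apply, LinearMap.smul_apply,
      LinearMap.sub_apply, bOp_withVac, add_zero, smul_zero] at hi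
    have := (smul_eq_zero.1 hi).resolve_left (by norm_num)
    simpa using sub_eq_zero.1 this
  · simp only [hp, Bool.not_true, outOp, LinearMap.add_apply, LinearMap.smul_apply,
      LinearMap.sub_apply, bOp_withVac, add_zero, smul_zero, sub_zero] at hi
    have := (smul_eq_zero.1 hi).resolve_left (by simp)
    simpa using eq_neg_of_add_eq_zero_left this

theorem NoBitError.aOp_eq {x : Fin (n + 1) → Bool} {Ψ : FockFun (Fin (n + 1)) E}
    (h : NoBitError x Ψ) (i : Fin (n + 1)) :
    aOp i (withVac Ψ) = relSign x i • aOp 0 (withVac Ψ) := by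
  induction i using Fin.induction with
  | zero => simp [relSign]
  | succ i ih => rw [h.aOp_succ, ih, smul_smul, relSign_succ]

/-- Without bit errors the output mode `k` acts as this multiple of the first received mode. -/
def outCoeff (x : Fin (n + 1) → Bool) : OutMode n → ℂ
  | .det i j => if j = phaseDiff x i then (if j then 1 else Complex.I) * relSign x i.succ else 0
  | .first => (((Real.sqrt 2)⁻¹ : ℝ) : ℂ)
  | .last => (((Real.sqrt 2)⁻¹ : ℝ) : ℂ) * (Complex.I * relSign x (Fin.last n))

theorem NoBitError.outOp_eq {x : Fin (n + 1) → Bool} {Ψ : FockFun (Fin (n + 1)) E}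
    (h : NoBitError x Ψ) (k : OutMode n) :
    outOp k (withVac Ψ) = outCoeff x k • aOp 0 (withVac Ψ) := by
  rcases k with ⟨i, j⟩ | _ | _
  · by_cases hj : j = phaseDiff x i
    -- The sign is its own inverse, so `relSign_succ` can be solved for the earlier pulse.
    · have hcs : relSign x i.castSucc = (if j then -1 else 1) * relSign x i.succ := by
        rw [relSign_succ, hj]
        cases phaseDiff x i <;> simp
      cases j <;>
      · simp only [outOp, LinearMap.add_apply, LinearMap.smul_apply, LinearMap.sub_apply,
          bOp_withVac, add_zero, smul_zero, sub_zero, h.aOp_eq i.succ, h.aOp_eq i.castSucc, hcs,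
          outCoeff, if_pos hj, ← add_smul, ← sub_smul, smul_smul]
        congr 1
        simp
        ring
    · have : j = !phaseDiff x i := by
        cases j <;> cases hp : phaseDiff x i <;> simp_all
      rw [outCoeff, if_neg hj, zero_smul, this]
      exact h i
  · simp [outOp, bOp_withVac, outCoeff]
  · simp [outOp, bOp_withVac, outCoeff, h.aOp_eq (Fin.last n), smul_smul, mul_assoc]

/-- The weight of an output mode: the squared norm of `outCoeff`. -/
def outWeight (x : Fin (n + 1) → Bool) : OutMode n → ℝ
  | .det i j => if j = phaseDiff x i then 1 else 0
  | .first => 1 / 2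
  | .last => 1 / 2

theorem norm_outCoeff_sq (x : Fin (n + 1) → Bool) (k : OutMode n) :
    ‖outCoeff x k‖ ^ 2 = outWeight x k := by
  rcases k with ⟨i, j⟩ | _ | _
  · simp only [outCoeff, outWeight]
    split_ifs <;> simp [norm_relSign]
  · simp [outCoeff, outWeight]
  · simp [outCoeff, outWeight, norm_relSign]

theorem outWeight_nonneg (x : Fin (n + 1) → Bool) (k : OutMode n) : 0 ≤ outWeight x k :=
  norm_outCoeff_sq x k ▸ sq_nonneg _

/-- The output modes as monitored modes together with the two unmonitored ones. -/
def outModeEquiv (n : ℕ) : OutMode n ≃ (Fin n × Bool) ⊕ Bool where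
  toFun
    | .det i j => .inl (i, j)
    | .first => .inr false
    | .last => .inr true
  invFun
    | .inl q => .det q.1 q.2
    | .inr false => .first
    | .inr true => .last
  left_inv k := by rcases k with ⟨i, j⟩ | _ | _ <;> rfl
  right_inv q := by rcases q with q | (_ | _) <;> rfl

theorem sum_outWeight (x : Fin (n + 1) → Bool) : ∑ k, outWeight x k = n + 1 := by
  rw [← (outModeEquiv n).symm.sum_comp, Fintype.sum_sum_type, Fintype.sum_prod_type]
  have h1 : ∀ i : Fin n, ∑ j, outWeight x ((outModeEquiv n).symm (.inl (i, j))) = 1 := by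
    intro i
    simp [outModeEquiv, outWeight]
  have h2 : ∑ j, outWeight x ((outModeEquiv n).symm (.inr j)) = 1 := by
    simp [outModeEquiv, outWeight]
    norm_num
  rw [h2, Finset.sum_congr rfl fun i _ => h1 i]
  simp

/-- The scalar factor of `amp` at the photon numbers `m`. -/
def ampCoeff (x : Fin (n + 1) → Bool) (m : OutMode n → ℕ) : ℂ :=
  (((Real.sqrt (∏ k, (m k).factorial : ℕ))⁻¹ : ℝ) : ℂ) * ∏ k, outCoeff x k ^ m k

theorem norm_ampCoeff_sq (x : Fin (n + 1) → Bool) (m : OutMode n → ℕ) :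
    ‖ampCoeff x m‖ ^ 2 = ∏ k, outWeight x k ^ m k / (m k).factorial := by
  have h : ∀ k, (‖outCoeff x k‖ ^ m k) ^ 2 = outWeight x k ^ m k := fun k => by
    rw [← norm_outCoeff_sq, ← pow_mul, ← pow_mul, mul_comm]
  rw [ampCoeff, norm_mul, mul_pow, norm_prod, ← Finset.prod_pow]
  simp only [norm_pow, h, Complex.norm_real, Real.norm_eq_abs, sq_abs, inv_pow, Nat.cast_prod, Finset.prod_div_distrib]
  rw [Real.sq_sqrt (Finset.prod_nonneg fun k _ => Nat.cast_nonneg _), inv_mul_eq_div]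

/-- The component `⟨vac| a₀ᴹ |Ψ⟩` of `E`. -/
def radial (Ψ : FockFun (Fin (n + 1)) E) (M : ℕ) : E :=
  ((Real.sqrt (M.factorial : ℝ) : ℝ) : ℂ) • Ψ (Pi.single 0 M)

theorem NoBitError.amp_eq {x : Fin (n + 1) → Bool} {Ψ : FockFun (Fin (n + 1)) E}
    (h : NoBitError x Ψ) (m : OutMode n → ℕ) :
    amp Ψ m = ampCoeff x m • radial Ψ (∑ k, m k) := by
  have hs : (fun j : Fin (n + 1) =>
      (Pi.single (Sum.inl 0) (∑ k, m k) : InMode n → ℕ) (Sum.inl j))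
        = Pi.single 0 (∑ k, m k) := by
    funext j
    simp [Pi.single_apply]
  have hv : withVac Ψ (Pi.single (Sum.inl 0) (∑ k, m k)) = Ψ (Pi.single 0 (∑ k, m k)) := by
    rw [withVac, if_pos (by simp), hs]
  have hprod := congrFun (noncommProd_pow_apply (fun k => commute_outOp_aOp k 0) h.outOp_eq m
    Finset.univ (fun k _ l _ _ => (outOp_commute k l).pow_pow (m k) (m l))) 0
  refine (congrArg _ hprod).trans ?_
  rw [Pi.smul_apply, aOp, annih_pow_apply_zero, ampCoeff, mul_smul, radial, hv]

theorem NoBitError.annih_eq {x : Fin (n + 1) → Bool} {Ψ : FockFun (Fin (n + 1)) E}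
    (h : NoBitError x Ψ) (i : Fin (n + 1)) : annih i Ψ = relSign x i • annih 0 Ψ := by
  apply withVac_injective
  rw [withVac_smul, ← aOp_withVac, ← aOp_withVac, h.aOp_eq]

/-! ### Permuting the detectors to match two announcements. -/

/-- The permutation of the output modes that moves the detectors by `σ` and maps the detectors that
agree with Alice's phase differences to each other. -/
def detPerm (x : Fin (n + 1) → Bool) (σ : Equiv.Perm (Fin n)) : Equiv.Perm (OutMode n) where
  toFun
    | .det i j => .det (σ i) (xor j (xor (phaseDiff x i) (phaseDiff x (σ i))))
    | .first => .first
    | .last => .last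
  invFun
    | .det i j => .det (σ.symm i) (xor j (xor (phaseDiff x i) (phaseDiff x (σ.symm i))))
    | .first => .first
    | .last => .last
  left_inv k := by
    rcases k with ⟨i, j⟩ | _ | _
    · simp only [Equiv.symm_apply_apply]
      cases j <;> cases phaseDiff x i <;> cases phaseDiff x (σ i) <;> rfl
    · rfl
    · rfl
  right_inv k := by
    rcases k with ⟨i, j⟩ | _ | _
    · simp only [Equiv.apply_symm_apply]
      cases j <;> cases phaseDiff x i <;> cases phaseDiff x (σ.symm i) <;> rfl
    · rfl
    · rfl

theorem outWeight_detPerm (x : Fin (n + 1) → Bool) (σ : Equiv.Perm (Fin n)) (k : OutMode n) :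
    outWeight x (detPerm x σ k) = outWeight x k := by
  rcases k with ⟨i, j⟩ | _ | _
  · simp only [detPerm, Equiv.coe_fn_mk, outWeight]
    cases j <;> cases phaseDiff x i <;> cases phaseDiff x (σ i) <;> rfl
  · rfl
  · rfl

/-- A possible swap of the two detectors at a position is invisible, because the announcement only
records whether either of them fired. -/
theorem announce_comp_detPerm (x : Fin (n + 1) → Bool) (σ : Equiv.Perm (Fin n))
    (m : OutMode n → ℕ) (i : Fin n) :
    announce (m ∘ detPerm x σ) i.succ = announce m (σ i).succ := by
  simp only [announce, Fin.cons_succ, Function.comp_apply, detPerm, Equiv.coe_fn_mk]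
  refine decide_eq_decide.2 ?_
  generalize xor (phaseDiff x i) (phaseDiff x (σ i)) = b
  cases b <;> simp [or_comm]

theorem announce_comp_detPerm_eq_iff (x : Fin (n + 1) → Bool) {σ : Equiv.Perm (Fin n)}
    {z z' : Fin (n + 1) → Bool} (hz : z 0 = false) (hz' : z' 0 = false)
    (hσ : ∀ i, z' (σ i).succ = z i.succ) (m : OutMode n → ℕ) :
    announce (m ∘ detPerm x σ) = z ↔ announce m = z' := by
  have hcons : ∀ (m : OutMode n → ℕ) (z : Fin (n + 1) → Bool), z 0 = false →
      (announce m = z ↔ ∀ i : Fin n, announce m i.succ = z i.succ) := by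
    intro m z hz
    rw [funext_iff, Fin.forall_fin_succ, hz]
    simp [announce]
  rw [hcons _ z hz, hcons m z' hz']
  simp only [announce_comp_detPerm, ← hσ]
  exact σ.forall_congr_right (q := fun i => announce m i.succ = z' i.succ)

theorem exists_perm_of_weight_eq {z z' : Fin (n + 1) → Bool} (hz : z 0 = false)
    (hz' : z' 0 = false) (hw : weight z = weight z') :
    ∃ σ : Equiv.Perm (Fin n), ∀ i, z' (σ i).succ = z i.succ := by
  have hcard : ∀ z : Fin (n + 1) → Bool, z 0 = false →
      Fintype.card {i : Fin n // z i.succ = true} = weight z := by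
    intro z hz
    rw [Fintype.card_subtype, weight, Fin.univ_succ, Finset.filter_cons, hz]
    simp [Finset.filter_map]
  have e : {i : Fin n // z i.succ = true} ≃ {i : Fin n // z' i.succ = true} :=
    Fintype.equivOfCardEq (by rw [hcard z hz, hcard z' hz', hw])
  -- Any bijection between the ones extends to a permutation, which then also matches the zeros.
  refine ⟨e.extendSubtype, fun i => ?_⟩
  by_cases hi : z i.succ = true
  · rw [hi, e.extendSubtype_mem i hi]
  · have := e.extendSubtype_not_mem i hi
    rw [Bool.not_eq_true] at hi this
    rw [hi, this]

end Modes

/-! ### Probabilities and states of Eve. -/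

section States

variable {n : ℕ} {E : Type*} [NormedAddCommGroup E] [InnerProductSpace ℂ E]

theorem norm_radial_sq (Ψ : FockFun (Fin (n + 1)) E) (M : ℕ) :
    ‖radial Ψ M‖ ^ 2 = M.factorial * ‖Ψ (Pi.single 0 M)‖ ^ 2 := by
  rw [radial, norm_smul, mul_pow, Complex.norm_real, Real.norm_eq_abs, sq_abs,
    Real.sq_sqrt (Nat.cast_nonneg _)]

theorem NoBitError.norm_amp_sq {x : Fin (n + 1) → Bool} {Ψ : FockFun (Fin (n + 1)) E}
    (h : NoBitError x Ψ) (m : OutMode n → ℕ) :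
    ‖amp Ψ m‖ ^ 2
      = (∏ k, outWeight x k ^ m k / (m k).factorial) * ‖radial Ψ (∑ k, m k)‖ ^ 2 := by
  rw [h.amp_eq, norm_smul, mul_pow, norm_ampCoeff_sq]

/-- The phase of `ampCoeff` cancels in the projector; only its squared modulus survives. -/
theorem NoBitError.rankOne_amp {x : Fin (n + 1) → Bool} {Ψ : FockFun (Fin (n + 1)) E}
    (h : NoBitError x Ψ) (m : OutMode n → ℕ) :
    InnerProductSpace.rankOne ℂ (amp Ψ m) (amp Ψ m)
      = ((∏ k, outWeight x k ^ m k / (m k).factorial : ℝ) : ℂ) •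
        InnerProductSpace.rankOne ℂ (radial Ψ (∑ k, m k)) (radial Ψ (∑ k, m k)) := by
  rw [h.amp_eq, ← norm_ampCoeff_sq, Complex.ofReal_pow, ← Complex.conj_mul']
  ext v
  simp [smul_smul, mul_comm, mul_left_comm]

/-- After scaling by `∏ (k i)!`, adding a photon to mode `i` gives `‖annih i Ψ k‖²` up to a factor
independent of `i`, and these norms agree as the relative signs have modulus 1. So all photons can
be moved to mode 0. The factors `1 ^ k i` display this as the multinomial form with unit weights. -/
theorem NoBitError.norm_apply_sq {x : Fin (n + 1) → Bool} {Ψ : FockFun (Fin (n + 1)) E}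
    (h : NoBitError x Ψ) (k : Fin (n + 1) → ℕ) :
    ‖Ψ k‖ ^ 2 = (∏ i, (1 : ℝ) ^ k i / (k i).factorial) * ‖radial Ψ (∑ i, k i)‖ ^ 2 := by
  set g : (Fin (n + 1) → ℕ) → ℝ := fun k => (∏ i, ((k i).factorial : ℝ)) * ‖Ψ k‖ ^ 2 with hg
  have hfac : ∀ (k : Fin (n + 1) → ℕ) (i : Fin (n + 1)),
      g (k + Pi.single i 1) = (∏ j, ((k j).factorial : ℝ)) * ‖annih i Ψ k‖ ^ 2 := by
    intro k i
    have h1 : ∏ j, (((k + Pi.single i 1 : Fin (n + 1) → ℕ) j).factorial : ℝ)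
        = (∏ j, ((k j).factorial : ℝ)) * ((k i : ℝ) + 1) := by
      rw [← Finset.mul_prod_erase _ _ (Finset.mem_univ i),
        ← Finset.mul_prod_erase _ (fun j => ((k j).factorial : ℝ)) (Finset.mem_univ i),
        Finset.prod_congr rfl (g := fun j => ((k j).factorial : ℝ)) fun j hj => by
          simp [(Finset.mem_erase.1 hj).1]]
      simp [Nat.factorial_succ]
      ring
    have h2 : (0 : ℝ) ≤ (k i : ℝ) + 1 := by positivity
    simp only [hg, h1, annih, LinearMap.coe_mk, AddHom.coe_mk, norm_smul, mul_pow,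
      Complex.norm_real, Real.norm_eq_abs, sq_abs, Real.sq_sqrt h2]
    ring
  have hshift : ∀ (k : Fin (n + 1) → ℕ) i, g (k + Pi.single i 1) = g (k + Pi.single 0 1) := by
    intro k i
    rw [hfac, hfac, h.annih_eq i, Pi.smul_apply, norm_smul, norm_relSign, one_mul]
  have key := eq_single_of_shift_invariant 0 g hshift k
  have hprod : ∏ i, (((Pi.single 0 (∑ i, k i) : Fin (n + 1) → ℕ) i).factorial : ℝ)
      = (∑ i, k i).factorial := by
    rw [Finset.prod_eq_single 0 (fun j _ hj => by simp [hj]) (by simp)]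
    simp
  simp only [hg, hprod] at key
  rw [norm_radial_sq, ← key]
  have h1 : (∏ k', ((k k').factorial : ℝ)) ≠ 0 :=
    Finset.prod_ne_zero_iff.2 fun k _ => by positivity
  simp only [one_pow, Finset.prod_div_distrib, Finset.prod_const_one]
  field_simp

theorem NoBitError.hasSum_norm_amp_sq {x : Fin (n + 1) → Bool} {Ψ : EveBob n E}
    (h : NoBitError x (Ψ : FockFun (Fin (n + 1)) E)) :
    HasSum (fun m : OutMode n → ℕ => ‖amp (Ψ : FockFun (Fin (n + 1)) E) m‖ ^ 2) (‖Ψ‖ ^ 2) := by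
  have hΨ : HasSum (fun k : Fin (n + 1) → ℕ => ‖Ψ k‖ ^ 2) (‖Ψ‖ ^ 2) := by
    have := lp.hasSum_norm (p := 2) (by norm_num) Ψ
    simpa using this
  simp only [h.norm_apply_sq] at hΨ
  simp only [h.norm_amp_sq]
  refine (hasSum_multinomial_iff (outWeight_nonneg x) (fun _ => zero_le_one) ?_
    (G := fun M => ‖radial (Ψ : FockFun (Fin (n + 1)) E) M‖ ^ 2) (fun M => sq_nonneg _)
    (sq_nonneg _)).2 hΨ
  simp [sum_outWeight]

/-- A sum over the photon numbers leading to an announcement only depends on the weight of the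
announcement, if its terms are determined by the photon number distribution up to `detPerm`. -/
theorem tsum_announce_eq {V : Type*} [AddCommMonoid V] [TopologicalSpace V]
    (x : Fin (n + 1) → Bool) {z z' : Fin (n + 1) → Bool} (hz : z 0 = false) (hz' : z' 0 = false)
    (hw : weight z = weight z') (f : (OutMode n → ℕ) → V)
    (hf : ∀ σ m, f (m ∘ detPerm x σ) = f m) :
    ∑' m : {m : OutMode n → ℕ // announce m = z}, f m.1
      = ∑' m : {m : OutMode n → ℕ // announce m = z'}, f m.1 := by
  obtain ⟨σ, hσ⟩ := exists_perm_of_weight_eq hz hz' hw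
  have e : ∀ m : OutMode n → ℕ,
      announce m = z' ↔ announce ((detPerm x σ).symm.arrowCongr (Equiv.refl ℕ) m) = z :=
    fun m => (announce_comp_detPerm_eq_iff x hz hz' hσ m).symm
  -- Reindexing along a bijection holds for `tsum` without summability, so convergence of the
  -- operator series plays no role.
  rw [← (Equiv.subtypeEquiv ((detPerm x σ).symm.arrowCongr (Equiv.refl ℕ)) e).tsum_eq]
  exact tsum_congr fun m => hf σ m.1

theorem prod_outWeight_comp_detPerm (x : Fin (n + 1) → Bool) (σ : Equiv.Perm (Fin n))
    (m : OutMode n → ℕ) :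
    ∏ k, outWeight x k ^ (m ∘ detPerm x σ) k / ((m ∘ detPerm x σ) k).factorial
      = ∏ k, outWeight x k ^ m k / (m k).factorial := by
  rw [← Equiv.prod_comp (detPerm x σ) fun k => outWeight x k ^ m k / (m k).factorial]
  simp [outWeight_detPerm]

theorem sum_comp_detPerm (x : Fin (n + 1) → Bool) (σ : Equiv.Perm (Fin n)) (m : OutMode n → ℕ) :
    ∑ k, (m ∘ detPerm x σ) k = ∑ k, m k :=
  Equiv.sum_comp (detPerm x σ) m

theorem NoBitError.probZGivenX_eq {x z z' : Fin (n + 1) → Bool} {Ψ : EveBob n E}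
    (h : NoBitError x (Ψ : FockFun (Fin (n + 1)) E)) (hz : z 0 = false) (hz' : z' 0 = false)
    (hw : weight z = weight z') : probZGivenX Ψ z = probZGivenX Ψ z' :=
  tsum_announce_eq x hz hz' hw (fun m => ‖amp (Ψ : FockFun (Fin (n + 1)) E) m‖ ^ 2)
    fun σ m => by
      simp only [h.norm_amp_sq, prod_outWeight_comp_detPerm, sum_comp_detPerm]

theorem NoBitError.eveStateXZ_eq {x z z' : Fin (n + 1) → Bool} {Ψ : EveBob n E}
    (h : NoBitError x (Ψ : FockFun (Fin (n + 1)) E)) (hz : z 0 = false) (hz' : z' 0 = false)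
    (hw : weight z = weight z') : eveStateXZ Ψ z = eveStateXZ Ψ z' := by
  rw [eveStateXZ, eveStateXZ, h.probZGivenX_eq hz hz' hw,
    tsum_announce_eq x hz hz' hw (fun m => InnerProductSpace.rankOne ℂ
      (amp (Ψ : FockFun (Fin (n + 1)) E) m) (amp (Ψ : FockFun (Fin (n + 1)) E) m))
      fun σ m => by
        simp only [h.rankOne_amp, prod_outWeight_comp_detPerm, sum_comp_detPerm]]

end States

end DPS

end

theorem lemma2 (n : ℕ) {E : Type*} [NormedAddCommGroup E] [InnerProductSpace ℂ E] [CompleteSpace E]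
    (p : (Fin (n + 1) → Bool) → ℝ) (hp_nonneg : ∀ x, 0 ≤ p x) (hp_sum : ∑ x, p x = 1)
    (Ψ : (Fin (n + 1) → Bool) → DPS.EveBob n E) (hΨ : ∀ x, ‖Ψ x‖ = 1)
    (hno : ∀ x, DPS.NoBitError x (Ψ x : DPS.FockFun (Fin (n + 1)) E)) :
    (∀ x, HasSum (fun m : DPS.OutMode n → ℕ =>
      ‖DPS.amp (Ψ x : DPS.FockFun (Fin (n + 1)) E) m‖ ^ 2) 1) ∧
    ∀ z z' : Fin (n + 1) → Bool, z 0 = false → z' 0 = false → DPS.weight z = DPS.weight z' →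
      (∀ x, DPS.eveStateXZ (Ψ x) z = DPS.eveStateXZ (Ψ x) z') ∧
      DPS.eveStateZ p Ψ z = DPS.eveStateZ p Ψ z' ∧
      (∀ x, DPS.probZGivenX (Ψ x) z = DPS.probZGivenX (Ψ x) z') ∧
      (∀ x, DPS.probZX p Ψ z x = DPS.probZX p Ψ z' x) ∧
      DPS.probZ p Ψ z = DPS.probZ p Ψ z' ∧
      (∀ x, DPS.probXGivenZ p Ψ x z = DPS.probXGivenZ p Ψ x z') := by
  refine ⟨fun x => by simpa [hΨ x] using (hno x).hasSum_norm_amp_sq, fun z z' hz hz' hw => ?_⟩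
  have h1 : ∀ x, DPS.eveStateXZ (Ψ x) z = DPS.eveStateXZ (Ψ x) z' :=
    fun x => (hno x).eveStateXZ_eq hz hz' hw
  have h3 : ∀ x, DPS.probZGivenX (Ψ x) z = DPS.probZGivenX (Ψ x) z' :=
    fun x => (hno x).probZGivenX_eq hz hz' hw
  have h4 : ∀ x, DPS.probZX p Ψ z x = DPS.probZX p Ψ z' x := fun x => by
    rw [DPS.probZX, DPS.probZX, h3]
  have h5 : DPS.probZ p Ψ z = DPS.probZ p Ψ z' := Finset.sum_congr rfl fun x _ => h4 x
  have h6 : ∀ x, DPS.probXGivenZ p Ψ x z = DPS.probXGivenZ p Ψ x z' := fun x => by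
    rw [DPS.probXGivenZ, DPS.probXGivenZ, h4, h5]
  exact ⟨h1, Finset.sum_congr rfl fun x _ => by rw [h1, h6], h3, h4, h5, h6⟩
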